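/- Let $W$ be a graphon on an arbitrary probability space $(\mathcal S,\mu)$, i.e. a symmetric measurable function $W:\mathcal S^2\to[0,1]$. Then $W$ is random-free, i.e. $W(x,y)\in\{0,1\}$ for $\mu^2$-a.e. $(x,y)$, if and only if there is a sequence $(G_n)$ of finite simple non-empty graphs with $\delta_1(W_{G_n},W)\to0$. Here, for graphons $W_1,W_2$ on probability spaces $(\mathcal S_1,\mu_1),(\mathcal S_2,\mu_2)$, $$\delta_1(W_1,W_2)=\inf_{\varphi_1,\varphi_2}\int_{\mathcal S'^2}\bigl|W_1(\varphi_1(x),\varphi_1(y))-W_2(\varphi_2(x),\varphi_2(y))\bigr|\,d\nu(x)\,d\nu(y),$$ the infimum being over all couplings, i.e. pairs of measure preserving maps $\varphi_i:(\mathcal S',\nu)\to(\mathcal S_i,\mu_i)$, $i=1,2$, defined on a common, arbitrary probability space $(\mathcal S',\nu)$. For a graph $G$ with vertices $1,\dots,m$, $W_G$ denotes either the adjacency matrix of $G$, regarded as a graphon on $\{1,\dots,m\}$ with the uniform probability measure, or the graphon on $(0,1]$ with Lebesgue measure whose value on $(\frac{i-1}m,\frac im]\times(\frac{j-1}m,\frac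 jm]$ is $1$ if $i$ and $j$ are adjacent and $0$ otherwise; the equivalence holds with either choice. -/

import Mathlib

open MeasureTheory Filter Topology

/-- A graphon on a measurable space `Ω`: a symmetric function `Ω² → [0,1]`, measurable for the
product `σ`-field. -/
structure Graphon (Ω : Type*) [MeasurableSpace Ω] where
  toFun : Ω → Ω → ℝ
  symm' : ∀ x y, toFun x y = toFun y x
  mem_Icc' : ∀ x y, toFun x y ∈ Set.Icc (0 : ℝ) 1
  measurable' : Measurable fun p : Ω × Ω => toFun p.1 p.2

namespace Graphon

instance {Ω : Type*} [MeasurableSpace Ω] : CoeFun (Graphon Ω) fun _ => Ω → Ω → ℝ := ⟨toFun⟩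

/-- A graphon on the probability space `(Ω, μ)` is random-free if its values are a.e. in
`{0, 1}`. -/
def IsRandomFree {Ω : Type*} [MeasurableSpace Ω] (W : Graphon Ω) (μ : Measure Ω) : Prop :=
  ∀ᵐ p ∂(μ.prod μ), W p.1 p.2 ∈ ({0, 1} : Set ℝ)

/-- The pull-back `W^φ (x, y) = W (φ x, φ y)` along a measurable map `φ`. -/
def pullback {Ω Ω' : Type*} [MeasurableSpace Ω] [MeasurableSpace Ω'] (W : Graphon Ω')
    (φ : Ω → Ω') (hφ : Measurable φ) : Graphon Ω where
  toFun x y := W (φ x) (φ y)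
  symm' _ _ := W.symm' _ _
  mem_Icc' _ _ := W.mem_Icc' _ _
  measurable' := W.measurable'.comp
    ((hφ.comp measurable_fst).prodMk (hφ.comp measurable_snd))

/-- A coupling of the probability spaces `(Ω₁, μ₁)` and `(Ω₂, μ₂)`: a pair of measure preserving
maps `φᵢ : Ω → Ωᵢ` on a common, arbitrary probability space `(Ω, μ)`. (The restriction on the
universe of `Ω` is harmless, see `l1Dist_le` below.) -/
structure Coupling.{u, v} {Ω₁ : Type u} {Ω₂ : Type v} [MeasurableSpace Ω₁] [MeasurableSpace Ω₂]
    (μ₁ : Measure Ω₁) (μ₂ : Measure Ω₂) where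
  space : Type (max u v)
  [mspace : MeasurableSpace space]
  measure : Measure space
  [isProb : IsProbabilityMeasure measure]
  fst : space → Ω₁
  snd : space → Ω₂
  fst_mp : MeasurePreserving fst measure μ₁
  snd_mp : MeasurePreserving snd measure μ₂

attribute [instance] Coupling.mspace Coupling.isProb

/-- The `L¹` norm of `W₁ - W₂` on `(Ω, μ)²`. -/
noncomputable def l1Norm {Ω : Type*} [MeasurableSpace Ω] (μ : Measure Ω) (W₁ W₂ : Graphon Ω) : ℝ :=
  ∫ p : Ω × Ω, |W₁ p.1 p.2 - W₂ p.1 p.2| ∂(μ.prod μ)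

/-- The distance `δ₁(W₁, W₂)`: the infimum, over all couplings `(φ₁, φ₂)` of `(Ω₁, μ₁)` and
`(Ω₂, μ₂)`, of the `L¹` norm of `W₁^φ₁ - W₂^φ₂`. -/
noncomputable def l1Dist {Ω₁ Ω₂ : Type*} [MeasurableSpace Ω₁] [MeasurableSpace Ω₂]
    (μ₁ : Measure Ω₁) (μ₂ : Measure Ω₂) (W₁ : Graphon Ω₁) (W₂ : Graphon Ω₂) : ℝ :=
  ⨅ c : Coupling μ₁ μ₂,
    l1Norm c.measure (W₁.pullback c.fst c.fst_mp.measurable)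
      (W₂.pullback c.snd c.snd_mp.measurable)

/-- The infimum defining `δ₁` is over a non-empty family. -/
instance {Ω₁ Ω₂ : Type*} [MeasurableSpace Ω₁] [MeasurableSpace Ω₂]
    (μ₁ : Measure Ω₁) (μ₂ : Measure Ω₂) [IsProbabilityMeasure μ₁] [IsProbabilityMeasure μ₂] :
    Nonempty (Coupling μ₁ μ₂) :=
  ⟨{ space := Ω₁ × Ω₂
     measure := μ₁.prod μ₂
     fst := Prod.fst
     snd := Prod.snd
     fst_mp := measurePreserving_fst
     snd_mp := measurePreserving_snd }⟩

theorem l1Norm_nonneg {Ω : Type*} [MeasurableSpace Ω] (μ : Measure Ω) (W₁ W₂ : Graphon Ω) :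
    0 ≤ l1Norm μ W₁ W₂ :=
  integral_nonneg fun _ => abs_nonneg _

/-- `δ₁` is a lower bound for couplings defined on a probability space in any universe. -/
theorem l1Dist_le {Ω₁ Ω₂ Ω : Type*} [MeasurableSpace Ω₁] [MeasurableSpace Ω₂] [MeasurableSpace Ω]
    {μ₁ : Measure Ω₁} {μ₂ : Measure Ω₂} (W₁ : Graphon Ω₁) (W₂ : Graphon Ω₂)
    (μ : Measure Ω) [IsProbabilityMeasure μ] {φ₁ : Ω → Ω₁} {φ₂ : Ω → Ω₂}
    (h₁ : MeasurePreserving φ₁ μ μ₁) (h₂ : MeasurePreserving φ₂ μ μ₂) :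
    l1Dist μ₁ μ₂ W₁ W₂ ≤
      l1Norm μ (W₁.pullback φ₁ h₁.measurable) (W₂.pullback φ₂ h₂.measurable) := by
  have hm : Measurable fun x => (φ₁ x, φ₂ x) := h₁.measurable.prodMk h₂.measurable
  have hp : IsProbabilityMeasure (μ.map fun x => (φ₁ x, φ₂ x)) :=
    Measure.isProbabilityMeasure_map hm.aemeasurable
  have hΦ : MeasurePreserving (fun x => (φ₁ x, φ₂ x)) μ (μ.map fun x => (φ₁ x, φ₂ x)) :=
    hm.measurePreserving μ
  let c : Coupling μ₁ μ₂ :=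
    { space := Ω₁ × Ω₂
      measure := μ.map fun x => (φ₁ x, φ₂ x)
      fst := Prod.fst
      snd := Prod.snd
      fst_mp := ⟨measurable_fst, by rw [Measure.map_map measurable_fst hm]; exact h₁.map_eq⟩
      snd_mp := ⟨measurable_snd, by rw [Measure.map_map measurable_snd hm]; exact h₂.map_eq⟩ }
  refine (ciInf_le ⟨0, ?_⟩ c).trans_eq ?_
  · rintro _ ⟨d, rfl⟩
    exact l1Norm_nonneg _ _ _
  · have h := (hΦ.prod hΦ).map_eq
    simp only [l1Norm, c]
    rw [← h, integral_map (hΦ.prod hΦ).measurable.aemeasurable]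
    · rfl
    · exact (((W₁.pullback Prod.fst measurable_fst).measurable'.sub
        (W₂.pullback Prod.snd measurable_snd).measurable').abs).aestronglyMeasurable

end Graphon

/-- A finite simple graph with a non-empty vertex set, labelled by `Fin order`. -/
structure FiniteGraph where
  order : ℕ
  order_pos : 0 < order
  graph : SimpleGraph (Fin order)

namespace FiniteGraph

/-- The uniform probability measure on the vertices. -/
noncomputable def vertexMeasure (G : FiniteGraph) : Measure (Fin G.order) :=
  ProbabilityTheory.uniformOn Set.univ

instance (G : FiniteGraph) : IsProbabilityMeasure G.vertexMeasure := by
  have : Nonempty (Fin G.order) := ⟨⟨0, G.order_pos⟩⟩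
  exact ProbabilityTheory.isProbabilityMeasure_uniformOn Set.finite_univ Set.univ_nonempty

open Classical in
/-- The adjacency matrix of `G`, as a graphon on its vertex set. -/
noncomputable def vertexGraphon (G : FiniteGraph) : Graphon (Fin G.order) where
  toFun u v := if G.graph.Adj u v then 1 else 0
  symm' u v := by simp only [G.graph.adj_comm]
  mem_Icc' u v := by split_ifs <;> simp
  measurable' := Measurable.of_discrete

/-- The index `i` of the interval `(i/n, (i+1)/n]`, `0 ≤ i < n = |G|`, that contains
`x ∈ (0, 1]`. -/
noncomputable def cell (G : FiniteGraph) (x : Set.Ioc (0 : ℝ) 1) : Fin G.order :=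
  ⟨⌈(G.order : ℝ) * x⌉₊ - 1, by
    have h : ⌈(G.order : ℝ) * x⌉₊ ≤ G.order :=
      Nat.ceil_le.2 (mul_le_of_le_one_right (Nat.cast_nonneg _) x.2.2)
    have := G.order_pos
    omega⟩

theorem cell_eq_iff (G : FiniteGraph) (x : Set.Ioc (0 : ℝ) 1) (i : Fin G.order) :
    G.cell x = i ↔
      (x : ℝ) ∈ Set.Ioc ((i : ℝ) / G.order) (((i : ℝ) + 1) / G.order) := by
  have hn : (0 : ℝ) < G.order := Nat.cast_pos.2 G.order_pos
  have hpos : 0 < ⌈(G.order : ℝ) * x⌉₊ := Nat.ceil_pos.2 (mul_pos hn x.2.1)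
  have h1 : G.cell x = i ↔ ⌈(G.order : ℝ) * x⌉₊ = (i : ℕ) + 1 := by
    rw [Fin.ext_iff]
    simp only [cell]
    omega
  rw [h1, Nat.ceil_eq_iff (Nat.succ_ne_zero _), Set.mem_Ioc, div_lt_iff₀ hn, le_div_iff₀ hn,
    mul_comm (x : ℝ)]
  simp

theorem measurable_cell (G : FiniteGraph) : Measurable G.cell := by
  refine measurable_to_countable' fun i => ?_
  have : G.cell ⁻¹' {i} =
      Subtype.val ⁻¹' Set.Ioc ((i : ℝ) / G.order) (((i : ℝ) + 1) / G.order) := by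
    ext x
    exact G.cell_eq_iff x i
  rw [this]
  exact measurable_subtype_coe measurableSet_Ioc

/-- Lebesgue measure on `(0, 1]`. -/
noncomputable def intervalMeasure : Measure (Set.Ioc (0 : ℝ) 1) :=
  Measure.comap Subtype.val volume

instance : IsProbabilityMeasure intervalMeasure :=
  ⟨by rw [intervalMeasure, comap_subtype_coe_apply measurableSet_Ioc, Set.image_univ,
    Subtype.range_coe, Real.volume_Ioc, sub_zero, ENNReal.ofReal_one]⟩

/-- The graphon of `G` on `(0, 1]`: its value on `(i/n, (i+1)/n] × (j/n, (j+1)/n]` is the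
`(i, j)` entry of the adjacency matrix. -/
noncomputable def intervalGraphon (G : FiniteGraph) : Graphon (Set.Ioc (0 : ℝ) 1) :=
  G.vertexGraphon.pullback G.cell G.measurable_cell

end FiniteGraph

/-!
A graph has a `{0, 1}`-valued graphon, and couplings preserve `∫ min (W, 1 - W)`, which is therefore
a lower bound for the distance from `W` to any graph (`Graphon.integral_min_le_l1Dist`). If these
distances tend to `0`, the integral vanishes and `W` is random-free.

Conversely, let `W` be random-free, so that `W` is a.e. the indicator of a measurable set of pairs.
Such sets are approximated in measure by sets determined by a measurable partition, so `W` is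
`L¹`-close to `U (f x, f y)` for some `f : Ω → ℕ` and some `{0, 1}`-valued graphon `U` on `ℕ`
(`Graphon.IsRandomFree.exists_pullback_nat`). The law of `f` is also the law of a quantile function
`g` on `(0, 1]`, which is a step function (`FiniteGraph.exists_measurePreserving_nat`); hence
sampling `U (g s, g t)` at the points of a fine grid gives graphs that converge to it in `L¹`
(`FiniteGraph.tendsto_l1Norm_gridGraph`). Since `f` and `g` have the same law, there is a coupling
of `(0, 1]` and `Ω` under which `g = f` a.e. (`exists_coupling_of_map_eq`), so the two
approximations combine by the triangle inequality.

No assumption on the probability space is needed, because only the countable factor `f` of it is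
ever coupled with the interval. The two choices of the graphon of a graph are related by the
measure preserving map that sends a point to its cell (`FiniteGraph.l1Dist_vertexGraphon_le`).
-/

/-! ### The `L¹` norm and pull-backs -/

namespace Graphon

variable {Ω Ω' : Type*} [MeasurableSpace Ω] [MeasurableSpace Ω']

theorem integrable_abs_sub (μ : Measure Ω) [IsFiniteMeasure μ] (W₁ W₂ : Graphon Ω) :
    Integrable (fun p : Ω × Ω => |W₁ p.1 p.2 - W₂ p.1 p.2|) (μ.prod μ) := by
  refine Integrable.of_bound ((W₁.measurable'.sub W₂.measurable').abs).aestronglyMeasurable 1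
    (ae_of_all _ fun p => ?_)
  have h₁ := W₁.mem_Icc' p.1 p.2
  have h₂ := W₂.mem_Icc' p.1 p.2
  rw [Real.norm_eq_abs, abs_abs, abs_le]
  constructor <;> linarith [h₁.1, h₁.2, h₂.1, h₂.2]

theorem l1Norm_triangle (μ : Measure Ω) [IsFiniteMeasure μ] (W₁ W₂ W₃ : Graphon Ω) :
    l1Norm μ W₁ W₃ ≤ l1Norm μ W₁ W₂ + l1Norm μ W₂ W₃ := by
  unfold l1Norm
  rw [← integral_add (integrable_abs_sub μ W₁ W₂) (integrable_abs_sub μ W₂ W₃)]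
  exact integral_mono (integrable_abs_sub μ W₁ W₃)
    ((integrable_abs_sub μ W₁ W₂).add (integrable_abs_sub μ W₂ W₃))
    fun p => abs_sub_le _ _ _

theorem l1Norm_pullback {μ : Measure Ω} {ν : Measure Ω'} [SFinite μ] [SFinite ν] {φ : Ω → Ω'}
    (hφ : MeasurePreserving φ μ ν) (W₁ W₂ : Graphon Ω') :
    l1Norm μ (W₁.pullback φ hφ.measurable) (W₂.pullback φ hφ.measurable) = l1Norm ν W₁ W₂ := by
  unfold l1Norm
  rw [← (hφ.prod hφ).map_eq, integral_map (hφ.prod hφ).measurable.aemeasurable]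
  · rfl
  · exact ((W₁.measurable'.sub W₂.measurable').abs).aestronglyMeasurable

/-- Pull-backs along two maps that agree almost everywhere are indistinguishable in `L¹`. -/
theorem l1Norm_pullback_congr_left {μ : Measure Ω} [SFinite μ] {φ ψ : Ω → Ω'}
    (hφ : Measurable φ) (hψ : Measurable ψ) (h : φ =ᵐ[μ] ψ) (U : Graphon Ω') (W : Graphon Ω) :
    l1Norm μ (U.pullback φ hφ) W = l1Norm μ (U.pullback ψ hψ) W := by
  refine integral_congr_ae ?_
  filter_upwards [Measure.quasiMeasurePreserving_fst.ae h, Measure.quasiMeasurePreserving_snd.ae h]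
    with p h₁ h₂
  simp only [pullback, h₁, h₂]

/-! ### Limits of `{0, 1}`-valued graphons are random-free -/

/-- The `L¹` distance from `W` to the nearest `{0, 1}`-valued function is a lower bound for the
distance from `W` to every `{0, 1}`-valued graphon, since couplings preserve it. -/
theorem integral_min_le_l1Dist {ν : Measure Ω'} {μ : Measure Ω} [IsProbabilityMeasure ν]
    [IsProbabilityMeasure μ] (V : Graphon Ω') (hV : ∀ x y, V x y = 0 ∨ V x y = 1)
    (W : Graphon Ω) :
    ∫ p : Ω × Ω, min (W p.1 p.2) (1 - W p.1 p.2) ∂(μ.prod μ) ≤ l1Dist ν μ V W := by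
  refine le_ciInf fun c => ?_
  have hc := c.snd_mp.prod c.snd_mp
  have hmeas : Measurable fun p : Ω × Ω => min (W p.1 p.2) (1 - W p.1 p.2) :=
    W.measurable'.min (measurable_const.sub W.measurable')
  rw [← hc.map_eq, integral_map hc.measurable.aemeasurable hmeas.aestronglyMeasurable]
  refine integral_mono_of_nonneg (ae_of_all _ fun p => ?_) (integrable_abs_sub _ _ _)
    (ae_of_all _ fun p => ?_)
  · have h := W.mem_Icc' (c.snd p.1) (c.snd p.2)
    exact le_min h.1 (sub_nonneg.2 h.2)
  · have h := W.mem_Icc' (c.snd p.1) (c.snd p.2)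
    simp only [pullback, Prod.map]
    rcases hV (c.fst p.1) (c.fst p.2) with h' | h' <;> rw [h']
    · exact (min_le_left _ _).trans (by rw [zero_sub, abs_neg]; exact le_abs_self _)
    · exact (min_le_right _ _).trans (le_abs_self _)

theorem isRandomFree_of_integral_min_le_zero {μ : Measure Ω} [IsProbabilityMeasure μ]
    (W : Graphon Ω) (h : ∫ p : Ω × Ω, min (W p.1 p.2) (1 - W p.1 p.2) ∂(μ.prod μ) ≤ 0) :
    W.IsRandomFree μ := by
  have hnn : ∀ p : Ω × Ω, 0 ≤ min (W p.1 p.2) (1 - W p.1 p.2) := fun p =>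
    le_min (W.mem_Icc' _ _).1 (sub_nonneg.2 (W.mem_Icc' _ _).2)
  have hmeas : Measurable fun p : Ω × Ω => min (W p.1 p.2) (1 - W p.1 p.2) :=
    W.measurable'.min (measurable_const.sub W.measurable')
  have hint : Integrable (fun p : Ω × Ω => min (W p.1 p.2) (1 - W p.1 p.2)) (μ.prod μ) := by
    refine Integrable.of_bound hmeas.aestronglyMeasurable 1 (ae_of_all _ fun p => ?_)
    rw [Real.norm_of_nonneg (hnn p)]
    exact (min_le_left _ _).trans (W.mem_Icc' _ _).2
  have h0 := (integral_eq_zero_iff_of_nonneg hnn hint).1 (le_antisymm h (integral_nonneg hnn))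
  filter_upwards [h0] with p hp
  rcases min_choice (W p.1 p.2) (1 - W p.1 p.2) with h' | h'
  · exact Or.inl (h'.symm.trans hp)
  · exact Or.inr (sub_eq_zero.1 (h'.symm.trans hp)).symm

theorem isRandomFree_of_tendsto {μ : Measure Ω} [IsProbabilityMeasure μ] (W : Graphon Ω)
    {S : ℕ → Type*} [∀ n, MeasurableSpace (S n)] (ν : ∀ n, Measure (S n))
    [∀ n, IsProbabilityMeasure (ν n)] (V : ∀ n, Graphon (S n))
    (hV : ∀ n x y, V n x y = 0 ∨ V n x y = 1)
    (h : Tendsto (fun n => l1Dist (ν n) μ (V n) W) atTop (𝓝 0)) : W.IsRandomFree μ :=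
  isRandomFree_of_integral_min_le_zero W
    (ge_of_tendsto' h fun n => integral_min_le_l1Dist (V n) (hV n) W)

/-! ### Approximation along countable partitions -/

/-- The sets of pairs `(x, y)` determined by `(f x, f y)` for some countable measurable partition,
encoded as the fibres of a measurable map `f` to `ℕ`. -/
def partitionSets (Ω : Type*) [MeasurableSpace Ω] : Set (Set (Ω × Ω)) :=
  {S | ∃ f : Ω → ℕ, Measurable f ∧ ∃ B : Set (ℕ × ℕ), S = Prod.map f f ⁻¹' B}

theorem isSetAlgebra_partitionSets : IsSetAlgebra (partitionSets Ω) where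
  empty_mem := ⟨fun _ => 0, measurable_const, ∅, rfl⟩
  compl_mem := by
    rintro _ ⟨f, hf, B, rfl⟩
    exact ⟨f, hf, Bᶜ, rfl⟩
  union_mem := by
    rintro _ _ ⟨f, hf, B, rfl⟩ ⟨f', hf', B', rfl⟩
    -- The pairing function encodes the common refinement of the two partitions.
    refine ⟨fun x => Nat.pair (f x) (f' x),
      (Measurable.of_discrete (f := fun q : ℕ × ℕ => Nat.pair q.1 q.2)).comp (hf.prodMk hf'),
      {q | (q.1.unpair.1, q.2.unpair.1) ∈ B ∨ (q.1.unpair.2, q.2.unpair.2) ∈ B'}, ?_⟩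
    ext p
    simp [Prod.map]

theorem generateFrom_partitionSets :
    (Prod.instMeasurableSpace : MeasurableSpace (Ω × Ω)) =
      MeasurableSpace.generateFrom (partitionSets Ω) := by
  apply le_antisymm
  · rw [← generateFrom_prod]
    refine MeasurableSpace.generateFrom_mono ?_
    rintro _ ⟨s, hs, t, ht, rfl⟩
    classical
    have hs' : Measurable fun x => if x ∈ s then 1 else 0 :=
      Measurable.ite hs measurable_const measurable_const
    have ht' : Measurable fun x => if x ∈ t then 1 else 0 :=
      Measurable.ite ht measurable_const measurable_const
    refine ⟨fun x => Nat.pair (if x ∈ s then 1 else 0) (if x ∈ t then 1 else 0),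
      (Measurable.of_discrete (f := fun q : ℕ × ℕ => Nat.pair q.1 q.2)).comp (hs'.prodMk ht'),
      {q | q.1.unpair.1 = 1 ∧ q.2.unpair.2 = 1}, ?_⟩
    ext p
    simp [Prod.map]
  · refine MeasurableSpace.generateFrom_le ?_
    rintro _ ⟨f, hf, B, rfl⟩
    exact (hf.prodMap hf) (MeasurableSet.of_discrete)

/-- A random-free graphon is an `L¹` limit of `{0, 1}`-valued graphons that are constant on the
products of the parts of a countable partition. -/
theorem IsRandomFree.exists_pullback_nat {μ : Measure Ω} [IsProbabilityMeasure μ] {W : Graphon Ω}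
    (hW : W.IsRandomFree μ) {ε : ℝ} (hε : 0 < ε) :
    ∃ (f : Ω → ℕ) (hf : Measurable f) (U : Graphon ℕ), (∀ i j, U i j = 0 ∨ U i j = 1) ∧
      l1Norm μ (U.pullback f hf) W < ε := by
  classical
  let A : Set (Ω × Ω) := {p | W p.1 p.2 = 1}
  have hA : MeasurableSet A := W.measurable' (measurableSet_singleton 1)
  have hdense := Measure.MeasureDense.of_generateFrom_isSetAlgebra_finite (μ.prod μ)
    isSetAlgebra_partitionSets generateFrom_partitionSets
  obtain ⟨_, ⟨f, hf, B, rfl⟩, hB⟩ :=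
    hdense.approx A hA (measure_ne_top _ _) (ε / 2) (by positivity)
  set T : Set (Ω × Ω) := Prod.map f f ⁻¹' B with hT
  have hTm : MeasurableSet T := (hf.prodMap hf) MeasurableSet.of_discrete
  set D := symmDiff A T with hD
  have hDm : MeasurableSet D := hA.symmDiff hTm
  have hDε : (μ.prod μ).real D < ε / 2 :=
    (ENNReal.lt_ofReal_iff_toReal_lt (measure_ne_top _ _)).1 hB
  -- As `A` is symmetric, symmetrizing `B` adds at most the mirror image of `D` to the error.
  let U : Graphon ℕ :=
    { toFun := fun i j => if (i, j) ∈ B ∨ (j, i) ∈ B then 1 else 0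
      symm' := fun i j => by simp only [or_comm]
      mem_Icc' := fun i j => by split_ifs <;> simp
      measurable' := Measurable.of_discrete }
  refine ⟨f, hf, U, fun i j => ?_, ?_⟩
  · change (if _ then (1 : ℝ) else 0) = 0 ∨ (if _ then (1 : ℝ) else 0) = 1
    split_ifs <;> simp
  have hi : Integrable (D.indicator fun _ => (1 : ℝ)) (μ.prod μ) :=
    (integrable_const 1).indicator hDm
  have hsw : MeasurePreserving Prod.swap (μ.prod μ) (μ.prod μ) := Measure.measurePreserving_swap
  have hi' : Integrable (fun p : Ω × Ω => D.indicator (fun _ => (1 : ℝ)) p.swap) (μ.prod μ) :=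
    hsw.integrable_comp_of_integrable hi
  have h1 : ∫ p, D.indicator (fun _ => (1 : ℝ)) p ∂(μ.prod μ) = (μ.prod μ).real D := by
    rw [integral_indicator_const _ hDm, smul_eq_mul, mul_one]
  have h2 : ∫ p : Ω × Ω, D.indicator (fun _ => (1 : ℝ)) p.swap ∂(μ.prod μ) =
      (μ.prod μ).real D := by
    rw [← h1, integral_prod_swap]
  calc l1Norm μ (U.pullback f hf) W
      ≤ ∫ p : Ω × Ω, (D.indicator (fun _ => (1 : ℝ)) p + D.indicator (fun _ => (1 : ℝ)) p.swap)
          ∂(μ.prod μ) := by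
        refine integral_mono_ae (integrable_abs_sub _ _ _) (hi.add hi') ?_
        filter_upwards [hW] with p hp
        have hp' : W p.1 p.2 = 0 ∨ W p.1 p.2 = 1 := hp
        have hs := W.symm' p.1 p.2
        have hU : (U.pullback f hf) p.1 p.2 =
          if (f p.1, f p.2) ∈ B ∨ (f p.2, f p.1) ∈ B then 1 else 0 := rfl
        simp only [hU, Set.indicator_apply, hD, Set.mem_symmDiff, hT, A, Set.mem_ofPred_eq,
          Set.mem_preimage, Prod.map, Prod.fst_swap, Prod.snd_swap]
        change W p.1 p.2 = W p.2 p.1 at hs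
        rw [← hs]
        by_cases hb : (f p.1, f p.2) ∈ B <;> by_cases hb' : (f p.2, f p.1) ∈ B <;>
          rcases hp' with h | h <;> simp [hb, hb', h]
    _ < ε := by
        rw [integral_add hi hi', h1, h2]
        linarith

end Graphon

/-! ### Couplings over a countable factor -/

theorem measure_eq_tsum_inter_fiber {X : Type*} [MeasurableSpace X] (ρ : Measure X) {k : X → ℕ}
    (hk : Measurable k) {s : Set X} (hs : MeasurableSet s) : ρ s = ∑' i, ρ (s ∩ k ⁻¹' {i}) := by
  rw [← measure_iUnion (fun i j hij => Set.disjoint_left.2 ?_)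
    fun i => hs.inter (hk (measurableSet_singleton i)), ← Set.inter_iUnion]
  · congr 1
    ext x
    simp
  · rintro x ⟨-, hx⟩ ⟨-, hx'⟩
    exact hij (Eq.trans (Eq.symm hx) hx')

/-- The conditionally independent coupling of two spaces over a common countable factor. -/
theorem exists_coupling_of_map_eq {Ω Ω' : Type*} [MeasurableSpace Ω] [MeasurableSpace Ω']
    {μ : Measure Ω} {ν : Measure Ω'} [IsProbabilityMeasure μ] [IsProbabilityMeasure ν]
    {f : Ω → ℕ} {g : Ω' → ℕ} (hf : Measurable f) (hg : Measurable g)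
    (h : ν.map g = μ.map f) :
    ∃ m : Measure (Ω' × Ω), MeasurePreserving Prod.fst m ν ∧ MeasurePreserving Prod.snd m μ ∧
      ∀ᵐ z ∂m, g z.1 = f z.2 := by
  have hgm : ∀ i, MeasurableSet (g ⁻¹' {i}) := fun i => hg (measurableSet_singleton i)
  have hfm : ∀ i, MeasurableSet (f ⁻¹' {i}) := fun i => hf (measurableSet_singleton i)
  have heq : ∀ i, ν (g ⁻¹' {i}) = μ (f ⁻¹' {i}) := fun i => by
    rw [← Measure.map_apply hg (measurableSet_singleton i), h,
      Measure.map_apply hf (measurableSet_singleton i)]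
  -- Where a fibre has measure `0` the factor is infinite, but it multiplies the zero measure.
  let m : Measure (Ω' × Ω) := Measure.sum fun i =>
    (μ (f ⁻¹' {i}))⁻¹ • (ν.restrict (g ⁻¹' {i})).prod (μ.restrict (f ⁻¹' {i}))
  have hm : ∀ s t, MeasurableSet s → MeasurableSet t → m (s ×ˢ t) =
      ∑' i, (μ (f ⁻¹' {i}))⁻¹ * (ν (s ∩ g ⁻¹' {i}) * μ (t ∩ f ⁻¹' {i})) := by
    intro s t hs ht
    simp only [m, Measure.sum_apply _ (hs.prod ht), Measure.smul_apply, Measure.prod_prod,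
      smul_eq_mul, Measure.restrict_apply hs, Measure.restrict_apply ht]
  refine ⟨m, ⟨measurable_fst, ?_⟩, ⟨measurable_snd, ?_⟩, ?_⟩
  · ext s hs
    rw [Measure.map_apply measurable_fst hs, ← Set.prod_univ, hm s _ hs MeasurableSet.univ,
      measure_eq_tsum_inter_fiber ν hg hs]
    congr 1 with i
    rw [Set.univ_inter]
    by_cases h0 : μ (f ⁻¹' {i}) = 0
    · rw [measure_mono_null Set.inter_subset_right ((heq i).trans h0), zero_mul, mul_zero]
    · rw [mul_left_comm, ENNReal.inv_mul_cancel h0 (measure_ne_top _ _), mul_one]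
  · ext s hs
    rw [Measure.map_apply measurable_snd hs, ← Set.univ_prod, hm _ s MeasurableSet.univ hs,
      measure_eq_tsum_inter_fiber μ hf hs]
    congr 1 with i
    rw [Set.univ_inter, heq]
    by_cases h0 : μ (f ⁻¹' {i}) = 0
    · rw [measure_mono_null Set.inter_subset_right h0, mul_zero, mul_zero]
    · rw [← mul_assoc, ENNReal.inv_mul_cancel h0 (measure_ne_top _ _), one_mul]
  · refine (Measure.ae_sum_iff' (measurableSet_eq_fun (hg.comp measurable_fst)
      (hf.comp measurable_snd))).2 fun i => Measure.ae_smul_measure ?_ _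
    filter_upwards [Measure.quasiMeasurePreserving_fst.ae (ae_restrict_mem (hgm i)),
      Measure.quasiMeasurePreserving_snd.ae (ae_restrict_mem (hfm i))] with z h₁ h₂
    exact Eq.trans h₁ (Eq.symm h₂)

/-! ### Quantile functions and cells in the unit interval -/

namespace FiniteGraph

theorem intervalMeasure_apply (s : Set (Set.Ioc (0 : ℝ) 1)) :
    intervalMeasure s = volume (Subtype.val '' s) := by
  rw [intervalMeasure, comap_subtype_coe_apply measurableSet_Ioc]

theorem ae_coe_ne (c : ℝ) : ∀ᵐ x : Set.Ioc (0 : ℝ) 1 ∂intervalMeasure, (x : ℝ) ≠ c := by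
  rw [ae_iff, intervalMeasure_apply]
  refine measure_mono_null ?_ (Real.volume_singleton (a := c))
  rintro _ ⟨x, hx, rfl⟩
  exact not_not.1 hx

/-- Every probability measure on `ℕ` is the law of its quantile function on `(0, 1]`, a step
function with countably many steps. -/
theorem exists_measurePreserving_nat (ν : Measure ℕ) [IsProbabilityMeasure ν] :
    ∃ g : Set.Ioc (0 : ℝ) 1 → ℕ, MeasurePreserving g intervalMeasure ν ∧
      ∀ᵐ x ∂intervalMeasure, ∀ᶠ y in 𝓝 x, g y = g x := by
  let F : ℕ → ℝ := fun i => ν.real (Set.Iic i)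
  have hFmono : Monotone F := fun i j hij => measureReal_mono (Set.Iic_subset_Iic.2 hij)
  have hFlim : Tendsto F atTop (𝓝 1) := by
    have h := tendsto_measure_Iic_atTop ν
    rw [measure_univ] at h
    exact (ENNReal.tendsto_toReal ENNReal.one_ne_top).comp h
  have hF1 : ∀ i, F i ≤ 1 := fun i => measureReal_le_one
  -- The end point `1`, which may exceed all values of `F`, is sent to `0`.
  let g : Set.Ioc (0 : ℝ) 1 → ℕ := fun x => sInf {i | (x : ℝ) ≤ F i ∨ (x : ℝ) = 1}
  have hg : ∀ x i, g x ≤ i ↔ (x : ℝ) ≤ F i ∨ (x : ℝ) = 1 := by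
    intro x i
    have hne : {i | (x : ℝ) ≤ F i ∨ (x : ℝ) = 1}.Nonempty := by
      rcases x.2.2.lt_or_eq with hx | hx
      · obtain ⟨j, hj⟩ := (hFlim.eventually (lt_mem_nhds hx)).exists
        exact ⟨j, Or.inl hj.le⟩
      · exact ⟨0, Or.inr hx⟩
    refine ⟨fun h => ?_, fun h => Nat.sInf_le h⟩
    have h' : (x : ℝ) ≤ F (g x) ∨ (x : ℝ) = 1 := Nat.sInf_mem hne
    exact h'.imp_left fun h' => h'.trans (hFmono h)
  have hpre : ∀ i, g ⁻¹' Set.Iic i = Subtype.val ⁻¹' (Set.Iic (F i) ∪ {1}) := fun i => by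
    ext x
    exact hg x i
  have hgm : Measurable g := measurable_of_Iic fun i => by
    rw [hpre]
    exact measurable_subtype_coe (measurableSet_Iic.union (measurableSet_singleton 1))
  refine ⟨g, ⟨hgm, ?_⟩, ?_⟩
  · refine Measure.ext_of_Iic _ _ fun i => ?_
    rw [Measure.map_apply hgm measurableSet_Iic, hpre, intervalMeasure_apply,
      Subtype.image_preimage_coe, Set.inter_union_distrib_left,
      ← ofReal_measureReal (μ := ν) (s := Set.Iic i)]
    have h1 : Set.Ioc (0 : ℝ) 1 ∩ Set.Iic (F i) = Set.Ioc 0 (F i) := by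
      rw [Set.Ioc_inter_Iic, min_eq_right (hF1 i)]
    have h2 : volume (Set.Ioc (0 : ℝ) 1 ∩ {1}) = 0 :=
      measure_mono_null Set.inter_subset_right Real.volume_singleton
    rw [measure_congr (union_ae_eq_left_of_ae_eq_empty (ae_eq_empty.2 h2)), h1, Real.volume_Ioc,
      sub_zero]
  · filter_upwards [ae_coe_ne 1, ae_all_iff.2 fun i => ae_coe_ne (F i)] with x hx1 hxF
    have hcont : Tendsto (Subtype.val : Set.Ioc (0 : ℝ) 1 → ℝ) (𝓝 x) (𝓝 x) :=
      continuous_subtype_val.tendsto x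
    have hupper : ∀ᶠ y in 𝓝 x, g y ≤ g x := by
      have h := ((hg x (g x)).1 le_rfl).resolve_right hx1
      filter_upwards [hcont.eventually (gt_mem_nhds (h.lt_of_ne (hxF _)))] with y hy
      exact (hg y _).2 (Or.inl hy.le)
    have hlower : ∀ᶠ y in 𝓝 x, g x ≤ g y := by
      rcases Nat.eq_zero_or_pos (g x) with h0 | hpos
      · exact Eventually.of_forall fun y => h0 ▸ Nat.zero_le _
      · have h : ¬ g x ≤ g x - 1 := by omega
        rw [hg, not_or, not_le] at h
        filter_upwards [hcont.eventually (lt_mem_nhds h.1),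
          hcont.eventually (gt_mem_nhds (x.2.2.lt_of_ne hx1))] with y hy hy1
        have h' : ¬ g y ≤ g x - 1 := by
          rw [hg, not_or, not_le]
          exact ⟨hy, hy1.ne⟩
        omega
    filter_upwards [hupper, hlower] with y h₁ h₂ using le_antisymm h₁ h₂

theorem measurePreserving_cell (G : FiniteGraph) :
    MeasurePreserving G.cell intervalMeasure G.vertexMeasure := by
  refine ⟨G.measurable_cell, Measure.ext_of_singleton fun i => ?_⟩
  have hn : (0 : ℝ) < G.order := Nat.cast_pos.2 G.order_pos
  have hi : ((i : ℝ) + 1) / G.order ≤ 1 := by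
    rw [div_le_one hn]
    exact_mod_cast i.2
  have hset : Subtype.val '' (G.cell ⁻¹' {i}) =
      Set.Ioc ((i : ℝ) / G.order) (((i : ℝ) + 1) / G.order) := by
    ext t
    constructor
    · rintro ⟨x, hx, rfl⟩
      exact (G.cell_eq_iff x i).1 hx
    · intro ht
      exact ⟨⟨t, (by positivity : (0 : ℝ) ≤ (i : ℝ) / G.order).trans_lt ht.1, ht.2.trans hi⟩,
        (G.cell_eq_iff _ i).2 ht, rfl⟩
  rw [Measure.map_apply G.measurable_cell (measurableSet_singleton i), intervalMeasure_apply, hset,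
    Real.volume_Ioc, vertexMeasure, ProbabilityTheory.uniformOn_univ, Measure.count_singleton,
    Fintype.card_fin, ← sub_div, add_sub_cancel_left, ENNReal.ofReal_div_of_pos hn,
    ENNReal.ofReal_one, ENNReal.ofReal_natCast]

theorem vertexGraphon_eq_zero_or_one (G : FiniteGraph) (u v : Fin G.order) :
    G.vertexGraphon u v = 0 ∨ G.vertexGraphon u v = 1 := by
  classical
  change (if G.graph.Adj u v then (1 : ℝ) else 0) = 0 ∨ (if G.graph.Adj u v then (1 : ℝ) else 0) = 1
  split_ifs <;> simp

/-- Each coupling with `(0, 1]` induces one with the vertex set, through the cells. -/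
theorem l1Dist_vertexGraphon_le {Ω : Type*} [MeasurableSpace Ω] (μ : Measure Ω)
    [IsProbabilityMeasure μ] (W : Graphon Ω) (G : FiniteGraph) :
    Graphon.l1Dist G.vertexMeasure μ G.vertexGraphon W ≤
      Graphon.l1Dist intervalMeasure μ G.intervalGraphon W :=
  le_ciInf fun c => Graphon.l1Dist_le G.vertexGraphon W c.measure
    (G.measurePreserving_cell.comp c.fst_mp) c.snd_mp

/-! ### Graphs sampled on a grid -/

/-- The right end point of the `i`-th of the `n + 1` cells of equal length in `(0, 1]`. -/
noncomputable def gridPoint (n : ℕ) (i : Fin (n + 1)) : Set.Ioc (0 : ℝ) 1 :=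
  ⟨((i : ℝ) + 1) / ((n : ℝ) + 1), by positivity, by
    rw [div_le_one (by positivity)]
    exact_mod_cast i.2⟩

/-- The graph on `n + 1` vertices in which two distinct vertices are adjacent when `U` takes the
value `1` at the images under `g` of the corresponding grid points. -/
noncomputable def gridGraph (U : Graphon ℕ) (g : Set.Ioc (0 : ℝ) 1 → ℕ) (n : ℕ) : FiniteGraph where
  order := n + 1
  order_pos := n.succ_pos
  graph :=
    { Adj := fun u v => u ≠ v ∧ U (g (gridPoint n u)) (g (gridPoint n v)) = 1
      symm := ⟨fun _ _ h => ⟨h.1.symm, (U.symm' _ _).trans h.2⟩⟩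
      loopless := ⟨fun _ h => h.1 rfl⟩ }

theorem tendsto_gridPoint_cell (U : Graphon ℕ) (g : Set.Ioc (0 : ℝ) 1 → ℕ)
    (x : Set.Ioc (0 : ℝ) 1) :
    Tendsto (fun n => gridPoint n ((gridGraph U g n).cell x)) atTop (𝓝 x) := by
  rw [tendsto_subtype_rng]
  have hcell : ∀ n : ℕ, (x : ℝ) ∈ Set.Ioc
      ((((gridGraph U g n).cell x : ℕ) : ℝ) / ((n : ℝ) + 1))
      (((((gridGraph U g n).cell x : ℕ) : ℝ) + 1) / ((n : ℝ) + 1)) := fun n => by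
    have h := ((gridGraph U g n).cell_eq_iff x _).1 rfl
    simpa only [gridGraph, Nat.cast_add, Nat.cast_one] using h
  have hlim : Tendsto (fun n : ℕ => (x : ℝ) + 1 / ((n : ℝ) + 1)) atTop (𝓝 x) := by
    simpa using tendsto_const_nhds.add (tendsto_one_div_add_atTop_nhds_zero_nat (𝕜 := ℝ))
  refine tendsto_of_tendsto_of_tendsto_of_le_of_le tendsto_const_nhds hlim
    (fun n => (hcell n).2) fun n => ?_
  have h := (hcell n).1
  change ((((gridGraph U g n).cell x : ℕ) : ℝ) + 1) / ((n : ℝ) + 1) ≤ _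
  rw [add_div]
  linarith

/-- By dominated convergence: off the diagonal, two points lie in distinct cells of every fine
enough grid, so that the missing loops do not matter in the limit. -/
theorem tendsto_l1Norm_gridGraph (U : Graphon ℕ) (hU : ∀ i j, U i j = 0 ∨ U i j = 1)
    {g : Set.Ioc (0 : ℝ) 1 → ℕ} (hg : Measurable g)
    (hcont : ∀ᵐ x ∂intervalMeasure, ∀ᶠ y in 𝓝 x, g y = g x) :
    Tendsto (fun n => Graphon.l1Norm intervalMeasure (gridGraph U g n).intervalGraphon
      (U.pullback g hg)) atTop (𝓝 0) := by
  classical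
  have hdiag : ∀ᵐ p ∂(intervalMeasure.prod intervalMeasure), p.1 ≠ p.2 := by
    refine (Measure.ae_prod_iff_ae_ae
      (measurableSet_eq_fun measurable_fst measurable_snd).compl).2 (ae_of_all _ fun x => ?_)
    filter_upwards [ae_coe_ne x] with y hy hxy
    exact hy (congrArg Subtype.val hxy.symm)
  have hlim := tendsto_integral_of_dominated_convergence
    (μ := intervalMeasure.prod intervalMeasure)
    (F := fun n (p : Set.Ioc (0 : ℝ) 1 × Set.Ioc (0 : ℝ) 1) =>
      |(gridGraph U g n).intervalGraphon p.1 p.2 - U.pullback g hg p.1 p.2|)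
    (f := fun _ => 0) (fun _ => 1)
    (fun n => (Graphon.integrable_abs_sub _ _ _).aestronglyMeasurable) (integrable_const 1)
    (fun n => ae_of_all _ fun p => ?_) ?_
  · simpa only [integral_zero, Graphon.l1Norm] using hlim
  · have h₁ := (gridGraph U g n).intervalGraphon.mem_Icc' p.1 p.2
    have h₂ := (U.pullback g hg).mem_Icc' p.1 p.2
    rw [Real.norm_eq_abs, abs_abs, abs_le]
    constructor <;> linarith [h₁.1, h₁.2, h₂.1, h₂.2]
  · filter_upwards [hdiag, Measure.quasiMeasurePreserving_fst.ae hcont,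
      Measure.quasiMeasurePreserving_snd.ae hcont] with p hne h₁ h₂
    have t₁ := tendsto_gridPoint_cell U g p.1
    have t₂ := tendsto_gridPoint_cell U g p.2
    refine tendsto_const_nhds.congr' ?_
    filter_upwards [t₁.eventually h₁, t₂.eventually h₂,
      (t₁.prodMk_nhds t₂).eventually (isClosed_diagonal.isOpen_compl.mem_nhds hne)] with n e₁ e₂ hn
    have hval : (gridGraph U g n).intervalGraphon p.1 p.2 =
        if (gridGraph U g n).cell p.1 ≠ (gridGraph U g n).cell p.2 ∧
          U (g (gridPoint n ((gridGraph U g n).cell p.1)))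
            (g (gridPoint n ((gridGraph U g n).cell p.2))) = 1 then 1 else 0 := by
      simp only [intervalGraphon, Graphon.pullback, vertexGraphon]
      congr 1
    have hne' : (gridGraph U g n).cell p.1 ≠ (gridGraph U g n).cell p.2 := fun h =>
      hn (congrArg (gridPoint n) h)
    rw [hval, e₁, e₂]
    simp only [hne', ne_eq, not_false_eq_true, true_and, Graphon.pullback]
    rcases hU (g p.1) (g p.2) with h | h <;> simp [h]

end FiniteGraph

/-! ### Random-free graphons are limits of graphs -/

theorem Graphon.IsRandomFree.exists_l1Dist_lt {Ω : Type*} [MeasurableSpace Ω] {μ : Measure Ω}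
    [IsProbabilityMeasure μ] {W : Graphon Ω} (hW : W.IsRandomFree μ) {ε : ℝ} (hε : 0 < ε) :
    ∃ G : FiniteGraph,
      Graphon.l1Dist FiniteGraph.intervalMeasure μ G.intervalGraphon W < ε := by
  obtain ⟨f, hf, U, hU, hUW⟩ := hW.exists_pullback_nat (half_pos hε)
  have : IsProbabilityMeasure (μ.map f) := Measure.isProbabilityMeasure_map hf.aemeasurable
  obtain ⟨g, hg, hcont⟩ := FiniteGraph.exists_measurePreserving_nat (μ.map f)
  obtain ⟨m, hfst, hsnd, hm⟩ := exists_coupling_of_map_eq hf hg.measurable hg.map_eq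
  have : IsProbabilityMeasure m :=
    (Measure.isProbabilityMeasure_map_iff hfst.aemeasurable).1 (hfst.map_eq ▸ inferInstance)
  obtain ⟨n, hn⟩ := ((FiniteGraph.tendsto_l1Norm_gridGraph U hU hg.measurable hcont).eventually
    (gt_mem_nhds (half_pos hε))).exists
  set G := FiniteGraph.gridGraph U g n
  refine ⟨G, (Graphon.l1Dist_le G.intervalGraphon W m hfst hsnd).trans_lt ?_⟩
  -- Compare both graphons with the pull-back of `U`, which is the same along both factors.
  have hgm : Measurable fun z : Set.Ioc (0 : ℝ) 1 × Ω => g z.1 :=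
    hg.measurable.comp measurable_fst
  have hfm : Measurable fun z : Set.Ioc (0 : ℝ) 1 × Ω => f z.2 := hf.comp measurable_snd
  have h₁ : Graphon.l1Norm m (G.intervalGraphon.pullback Prod.fst hfst.measurable)
      (U.pullback _ hgm) = _ :=
    Graphon.l1Norm_pullback hfst G.intervalGraphon (U.pullback g hg.measurable)
  have h₂ : Graphon.l1Norm m (U.pullback _ hfm) (W.pullback Prod.snd hsnd.measurable) = _ :=
    Graphon.l1Norm_pullback hsnd (U.pullback f hf) W
  have h₃ := Graphon.l1Norm_pullback_congr_left hgm hfm hm U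
    (W.pullback Prod.snd hsnd.measurable)
  have h₄ := Graphon.l1Norm_triangle m (G.intervalGraphon.pullback Prod.fst hfst.measurable)
    (U.pullback _ hgm) (W.pullback Prod.snd hsnd.measurable)
  linarith

theorem Graphon.IsRandomFree.exists_tendsto {Ω : Type*} [MeasurableSpace Ω] {μ : Measure Ω}
    [IsProbabilityMeasure μ] {W : Graphon Ω} (hW : W.IsRandomFree μ) :
    ∃ G : ℕ → FiniteGraph, Tendsto
      (fun n => Graphon.l1Dist FiniteGraph.intervalMeasure μ (G n).intervalGraphon W)
      atTop (𝓝 0) := by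
  choose G hG using fun n : ℕ => hW.exists_l1Dist_lt (Nat.one_div_pos_of_nat (α := ℝ) (n := n))
  exact ⟨G, squeeze_zero (fun n => Real.iInf_nonneg fun c => Graphon.l1Norm_nonneg _ _ _)
    (fun n => (hG n).le) tendsto_one_div_add_atTop_nhds_zero_nat⟩

theorem mainTheorem10 {Ω : Type*} [MeasurableSpace Ω] (μ : Measure Ω)
    [IsProbabilityMeasure μ] (W : Graphon Ω) :
    (W.IsRandomFree μ ↔
      ∃ G : ℕ → FiniteGraph,
        Tendsto (fun n => Graphon.l1Dist (G n).vertexMeasure μ (G n).vertexGraphon W)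
          atTop (𝓝 0)) ∧
    (W.IsRandomFree μ ↔
      ∃ G : ℕ → FiniteGraph,
        Tendsto (fun n => Graphon.l1Dist FiniteGraph.intervalMeasure μ (G n).intervalGraphon W)
          atTop (𝓝 0)) := by
  refine ⟨⟨fun hW => ?_, ?_⟩, ⟨fun hW => hW.exists_tendsto, ?_⟩⟩
  · obtain ⟨G, hG⟩ := hW.exists_tendsto
    exact ⟨G, squeeze_zero (fun n => Real.iInf_nonneg fun c => Graphon.l1Norm_nonneg _ _ _)
      (fun n => FiniteGraph.l1Dist_vertexGraphon_le μ W (G n)) hG⟩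
  · rintro ⟨G, hG⟩
    exact W.isRandomFree_of_tendsto (fun n => (G n).vertexMeasure) (fun n => (G n).vertexGraphon)
      (fun n => (G n).vertexGraphon_eq_zero_or_one) hG
  · rintro ⟨G, hG⟩
    exact W.isRandomFree_of_tendsto (fun _ => FiniteGraph.intervalMeasure)
      (fun n => (G n).intervalGraphon)
      (fun n _ _ => (G n).vertexGraphon_eq_zero_or_one _ _) hG
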